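/- Let $d,m\ge 1$ be integers, let $\alpha_1,\dots,\alpha_m>0$, and let $\Omega=\mathbb{T}^d=\mathbb{R}^d/\mathbb{Z}^d$ be equipped with its normalized Lebesgue measure. For $T>0$ let $\mathcal{P}_T^{m,\infty}$ be the set of curves $p:[0,T]\to\Omega$ of class $W^{m,\infty}$ (i.e. $p$ is the projection of a continuous curve in $\mathbb{R}^d$ whose weak derivatives up to order $m$ are in $L^\infty([0,T])$) with $\|p^{(i)}\|_\infty\le\alpha_i$ for all $i\in\{1,\dots,m\}$, where $\|p^{(i)}\|_\infty$ is the essential supremum of the Euclidean norm of the $i$-th derivative. Let $\mathcal{M}(\mathcal{P}_T^{m,\infty})=\{p_*\gamma_T : p\in\mathcal{P}_T^{m,\infty}\}$, where $\gamma_T$ is the normalized Lebesgue measure on $[0,T]$. For $h:\Omega\to\mathbb{R}$ continuous and $\nu$ a finite signed measure on $\Omega$, let $(h\star\nu)(x)=\int_\Omega h(x-y)\,d\nu(y)$ and $\mathcal{N}_h(\nu)=\|h\star\nu\|_{L^2(\Omega)}$. Let $h:\Omega\to\mathbb{R}$ be a Lipschitz function, let $\pi$ be a Borel probability measure on $\Omega$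 and, for every $T>0$, let $\mu_T^*$ be any minimizer of $\mu\mapsto\mathcal{N}_h(\mu-\pi)$ over $\mathcal{M}(\mathcal{P}_T^{m,\infty})$. Then: (i) if all Fourier coefficients $\hat h(\xi)$, $\xi\in\mathbb{Z}^d$, are nonzero, then $\mu_T^*$ converges weakly to $\pi$ as $T\to\infty$, i.e. $\int_\Omega f\,d\mu_T^*\to\int_\Omega f\,d\pi$ for every continuous $f:\Omega\to\mathbb{R}$; (ii) $\mathcal{N}_h(\mu_T^*-\pi)=\mathcal{O}\left(T^{-\frac{m}{m(d+1)-1}}\right)$ as $T\to\infty$. -/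

import Mathlib

open MeasureTheory Filter Set
open scoped Topology ENNReal ContDiff Asymptotics

noncomputable section

namespace LineDrawing

/-- The normalized Lebesgue (Haar) measure `dx` on the torus `𝕋ᵈ = ℝᵈ / ℤᵈ`. -/
def torusVolume (d : ℕ) : Measure (UnitAddTorus (Fin d)) :=
  Measure.pi fun _ => AddCircle.haarAddCircle

/-- The quotient map `ℝᵈ → 𝕋ᵈ`. -/
def torusProj {d : ℕ} (x : EuclideanSpace ℝ (Fin d)) : UnitAddTorus (Fin d) :=
  fun i => (x i : UnitAddCircle)

/-- The convolution `(h ⋆ ν)(x) = ∫ h(x - y) dν(y)` of a function `h` on the torus with a finite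
signed measure `ν`. -/
def conv {d : ℕ} (h : UnitAddTorus (Fin d) → ℝ) (ν : SignedMeasure (UnitAddTorus (Fin d)))
    (x : UnitAddTorus (Fin d)) : ℝ :=
  ∫ᵛ y, h (x - y) ∂<•ν

/-- `𝒩_h(ν) = ‖h ⋆ ν‖₂`, the norm being that of `L²(𝕋ᵈ)`. -/
def kernelNorm {d : ℕ} (h : UnitAddTorus (Fin d) → ℝ)
    (ν : SignedMeasure (UnitAddTorus (Fin d))) : ℝ :=
  Real.sqrt (∫ x, (conv h ν x) ^ 2 ∂(torusVolume d))

/-- The signed measure `μ - π`. -/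
def diffMeasure {d : ℕ} (μ π : ProbabilityMeasure (UnitAddTorus (Fin d))) :
    SignedMeasure (UnitAddTorus (Fin d)) :=
  (μ : Measure (UnitAddTorus (Fin d))).toSignedMeasure -
    (π : Measure (UnitAddTorus (Fin d))).toSignedMeasure

/-- `g` is an `i`-th weak derivative of `q` on the interval `(0, T)`. -/
def IsWeakDeriv {d : ℕ} (T : ℝ) (i : ℕ) (q g : ℝ → EuclideanSpace ℝ (Fin d)) : Prop :=
  ∀ φ : ℝ → ℝ, ContDiff ℝ ∞ φ → HasCompactSupport φ → tsupport φ ⊆ Ioo 0 T →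
    ∫ t in Icc 0 T, iteratedDeriv i φ t • q t = (-1 : ℝ) ^ i • ∫ t in Icc 0 T, φ t • g t

/-- `q ∈ (W^{m,∞}([0, T]))ᵈ`: `q` has weak derivatives of all orders `0, …, m` in `L^∞([0, T])`.
Only the restriction of `q` to `[0, T]` matters. -/
def MemSobolevInfty {d : ℕ} (m : ℕ) (T : ℝ) (q : ℝ → EuclideanSpace ℝ (Fin d)) : Prop :=
  ∀ i ≤ m, ∃ g : ℝ → EuclideanSpace ℝ (Fin d),
    MemLp g ⊤ (volume.restrict (Icc 0 T)) ∧ IsWeakDeriv T i q g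

/-- The set `𝒫_T^{m,∞}` of admissible curves `p : [0, T] → 𝕋ᵈ` (as functions on `ℝ` whose values
outside `[0, T]` are irrelevant): `p` is given on `[0, T]` by a continuous curve `q` in `ℝᵈ`
of class `W^{m,∞}` whose weak derivatives satisfy `‖q⁽ⁱ⁾‖_∞ ≤ α i` for `1 ≤ i ≤ m`.
The lift `q` is determined by `p` up to a constant vector, so its derivatives are those of `p`. -/
def admissibleCurves (d m : ℕ) (α : ℕ → ℝ) (T : ℝ) : Set (ℝ → UnitAddTorus (Fin d)) :=
  {p | ∃ q : ℝ → EuclideanSpace ℝ (Fin d),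
    ContinuousOn q (Icc 0 T) ∧
    (∀ t ∈ Icc 0 T, p t = torusProj (q t)) ∧
    MemSobolevInfty m T q ∧
    ∀ i, 1 ≤ i → i ≤ m → ∃ g : ℝ → EuclideanSpace ℝ (Fin d),
      IsWeakDeriv T i q g ∧ AEStronglyMeasurable g (volume.restrict (Icc 0 T)) ∧
        eLpNorm g ⊤ (volume.restrict (Icc 0 T)) ≤ ENNReal.ofReal (α i)}

/-- The set `ℳ(𝒫_T^{m,∞})` of pushforwards `p_* γ_T` of the normalized Lebesgue measure `γ_T` on
`[0, T]` by admissible curves `p`. -/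
def curveMeasures (d m : ℕ) (α : ℕ → ℝ) (T : ℝ) :
    Set (ProbabilityMeasure (UnitAddTorus (Fin d))) :=
  {μ | ∃ p ∈ admissibleCurves d m α T,
    (μ : Measure (UnitAddTorus (Fin d))) =
      Measure.map p (ProbabilityTheory.cond volume (Icc 0 T))}

/-- `μ` is a projection of `π` on `ℳ(𝒫_T^{m,∞})`: a minimizer of `𝒩_h(ν - π)` over all `ν` in this
set. -/
def IsProjection {d : ℕ} (m : ℕ) (α : ℕ → ℝ) (h : UnitAddTorus (Fin d) → ℝ)
    (π : ProbabilityMeasure (UnitAddTorus (Fin d))) (T : ℝ)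
    (μ : ProbabilityMeasure (UnitAddTorus (Fin d))) : Prop :=
  μ ∈ curveMeasures d m α T ∧
    ∀ ν ∈ curveMeasures d m α T,
      kernelNorm h (diffMeasure μ π) ≤ kernelNorm h (diffMeasure ν π)

end LineDrawing

end

/-!
The points `k • (n⁻¹, n⁻², …, n⁻ᵈ)`, `k < nᵈ`, form an `n⁻¹`-net of the torus in which consecutive
points are at distance of order `n⁻¹`. A curve can visit them in order, resting at each one for a
time proportional to the mass that `π` gives to the points nearest to it. Moving from one point to
the next takes a time of order `n ^ (-1 / m)`, so as soon as `T ≥ n ^ (d + 1 - 1 / m)` at most a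
fraction of order `n⁻¹` of the time is spent moving, and the integrals of a Lipschitz function
against `π` and against the occupation measure of the curve differ by `O(n⁻¹)`. Applied to the
translates of `h` this gives the rate.

Conversely `|ĥ(ξ)| |μ̂(ξ) - π̂(ξ)| ≤ 𝒩_h(μ - π)`, so if no `ĥ(ξ)` vanishes the Fourier coefficients
of the minimizers converge to those of `π`, which implies weak convergence because trigonometric
polynomials are dense in the continuous functions.
-/

namespace LineDrawing

section IntegrationByParts

variable {E : Type*} [NormedAddCommGroup E] [NormedSpace ℝ E] {φ : ℝ → ℝ} {g : ℝ → E}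

theorem integral_deriv_smul_eq_neg_integral_smul_deriv (hφ : ContDiff ℝ 1 φ)
    (hφc : HasCompactSupport φ) (hg : ContDiff ℝ 1 g) :
    ∫ t, deriv φ t • g t = -∫ t, φ t • deriv g t := by
  have hφ' : Continuous (deriv φ) := hφ.continuous_deriv le_rfl
  have hg' : Continuous (deriv g) := hg.continuous_deriv le_rfl
  rw [eq_neg_iff_add_eq_zero, add_comm, ← eq_neg_iff_add_eq_zero]
  exact integral_bilinear_hasDerivAt_right_eq_neg_left_of_integrable
    (L := ContinuousLinearMap.lsmul ℝ ℝ)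
    (fun t _ => (hφ.differentiable one_ne_zero t).hasDerivAt)
    (fun t _ => (hg.differentiable one_ne_zero t).hasDerivAt)
    ((hφ.continuous.smul hg').integrable_of_hasCompactSupport hφc.smul_right)
    ((hφ'.smul hg.continuous).integrable_of_hasCompactSupport hφc.deriv.smul_right)
    ((hφ.continuous.smul hg.continuous).integrable_of_hasCompactSupport hφc.smul_right)

theorem integral_iteratedDeriv_smul {i : ℕ} (hφ : ContDiff ℝ i φ) (hφc : HasCompactSupport φ)
    (hg : ContDiff ℝ i g) :
    ∫ t, iteratedDeriv i φ t • g t = (-1 : ℝ) ^ i • ∫ t, φ t • iteratedDeriv i g t := by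
  induction i generalizing φ with
  | zero => simp
  | succ i ih =>
    have hφ' : ContDiff ℝ i (deriv φ) := hφ.deriv'
    have hgi : ContDiff ℝ 1 (iteratedDeriv i g) := by
      rw [iteratedDeriv_eq_iterate]
      exact ContDiff.iterate_deriv' 1 i (hg.of_le (by norm_cast; omega))
    rw [iteratedDeriv_succ', iteratedDeriv_succ, ih hφ' hφc.deriv (hg.of_le (by norm_cast; omega)),
      integral_deriv_smul_eq_neg_integral_smul_deriv (hφ.of_le (by norm_cast; omega)) hφc hgi,
      pow_succ, mul_neg_one, neg_smul, smul_neg]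

end IntegrationByParts

theorem support_iteratedDeriv_subset {𝕜 F : Type*} [NontriviallyNormedField 𝕜]
    [NormedAddCommGroup F] [NormedSpace 𝕜 F] (f : 𝕜 → F) (i : ℕ) :
    Function.support (iteratedDeriv i f) ⊆ tsupport f := fun x hx =>
  support_iteratedFDeriv_subset (𝕜 := 𝕜) i fun h0 => hx (by simp [iteratedDeriv, h0])

theorem isWeakDeriv_iteratedDeriv {d i : ℕ} {q : ℝ → EuclideanSpace ℝ (Fin d)}
    (hq : ContDiff ℝ i q) (T : ℝ) : IsWeakDeriv T i q (iteratedDeriv i q) := by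
  intro φ hφ hφc hsupp
  have hIcc : tsupport φ ⊆ Icc 0 T := hsupp.trans Ioo_subset_Icc_self
  rw [setIntegral_eq_integral_of_forall_compl_eq_zero,
    setIntegral_eq_integral_of_forall_compl_eq_zero,
    integral_iteratedDeriv_smul (hφ.of_le (by exact_mod_cast le_top)) hφc hq]
  · intro t ht
    rw [image_eq_zero_of_notMem_tsupport fun h => ht (hIcc h), zero_smul]
  · intro t ht
    rw [Function.notMem_support.1 fun h => ht (hIcc (support_iteratedDeriv_subset φ i h)),
      zero_smul]

theorem continuous_torusProj {d : ℕ} : Continuous (torusProj (d := d)) :=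
  continuous_pi fun i => (AddCircle.continuous_mk' (1 : ℝ)).comp (by fun_prop)

theorem torusProj_comp_mem_admissibleCurves {d m : ℕ} {α : ℕ → ℝ}
    {q : ℝ → EuclideanSpace ℝ (Fin d)} (hq : ContDiff ℝ m q)
    (hα : ∀ i, 1 ≤ i → i ≤ m → ∀ t, ‖iteratedDeriv i q t‖ ≤ α i) (T : ℝ) :
    torusProj ∘ q ∈ admissibleCurves d m α T := by
  have hweak {i : ℕ} (hi : i ≤ m) : IsWeakDeriv T i q (iteratedDeriv i q) :=
    isWeakDeriv_iteratedDeriv (hq.of_le (by exact_mod_cast hi)) T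
  have hcont {i : ℕ} (hi : i ≤ m) : Continuous (iteratedDeriv i q) :=
    hq.continuous_iteratedDeriv i (by exact_mod_cast hi)
  refine ⟨q, hq.continuous.continuousOn, fun _ _ => rfl,
    fun i hi => ⟨iteratedDeriv i q, ?_, hweak hi⟩,
    fun i hi₁ hi => ⟨iteratedDeriv i q, hweak hi, (hcont hi).aestronglyMeasurable, ?_⟩⟩
  · obtain ⟨C, hC⟩ := isCompact_Icc.exists_bound_of_continuousOn (hcont hi).continuousOn
    exact memLp_top_of_bound (hcont hi).aestronglyMeasurable C
      ((ae_restrict_iff' measurableSet_Icc).2 (Eventually.of_forall hC))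
  · simpa using eLpNorm_le_of_ae_bound (p := ⊤) (μ := volume.restrict (Icc 0 T))
      (Eventually.of_forall (hα i hi₁ hi))

theorem support_iteratedDeriv_smoothTransition_subset {i : ℕ} (hi : 1 ≤ i) :
    Function.support (iteratedDeriv i Real.smoothTransition) ⊆ Ioo 0 1 := by
  obtain ⟨j, rfl⟩ := Nat.exists_eq_add_of_le' hi
  have hderiv : Function.support (deriv Real.smoothTransition) ⊆ Icc 0 1 := by
    intro x hx
    by_contra hx01
    obtain hx0 | hx1 : x < 0 ∨ 1 < x := by
      simpa only [mem_Icc, not_and_or, not_le] using hx01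
    · refine hx ((EventuallyEq.deriv_eq (f := fun _ => (0 : ℝ)) ?_).trans (deriv_const _ _))
      filter_upwards [Iio_mem_nhds hx0] with y hy
      exact Real.smoothTransition.zero_of_nonpos (le_of_lt hy)
    · refine hx ((EventuallyEq.deriv_eq (f := fun _ => (1 : ℝ)) ?_).trans (deriv_const _ _))
      filter_upwards [Ioi_mem_nhds hx1] with y hy
      exact Real.smoothTransition.one_of_one_le (le_of_lt hy)
  have hclosed : Function.support (iteratedDeriv (j + 1) Real.smoothTransition) ⊆ Icc 0 1 := by
    rw [iteratedDeriv_succ']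
    exact (support_iteratedDeriv_subset _ j).trans (closure_minimal hderiv isClosed_Icc)
  have hcont : Continuous (iteratedDeriv (j + 1) Real.smoothTransition) :=
    (Real.smoothTransition.contDiff (n := ⊤)).continuous_iteratedDeriv _
      (by exact_mod_cast le_top)
  simpa only [interior_Icc] using interior_maximal hclosed hcont.isOpen_support

theorem exists_bound_iteratedDeriv_smoothTransition {i : ℕ} (hi : 1 ≤ i) :
    ∃ C : ℝ, ∀ x, |iteratedDeriv i Real.smoothTransition x| ≤ C := by
  have hcont : Continuous (iteratedDeriv i Real.smoothTransition) :=
    (Real.smoothTransition.contDiff (n := ⊤)).continuous_iteratedDeriv i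
      (by exact_mod_cast le_top)
  exact hcont.bounded_above_of_compact_support <| HasCompactSupport.of_support_subset_isCompact
    isCompact_Icc ((support_iteratedDeriv_smoothTransition_subset hi).trans Ioo_subset_Icc_self)

/-! ### Smooth staircases -/

theorem norm_sum_le_of_unique_ne_zero {ι E : Type*} [SeminormedAddCommGroup E] {s : Finset ι}
    {f : ι → E} {B : ℝ} (hB : 0 ≤ B) (hf : ∀ k ∈ s, ‖f k‖ ≤ B)
    (huniq : ∀ j ∈ s, ∀ k ∈ s, f j ≠ 0 → f k ≠ 0 → j = k) : ‖∑ k ∈ s, f k‖ ≤ B := by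
  by_cases hex : ∃ k ∈ s, f k ≠ 0
  · obtain ⟨k, hk, hk0⟩ := hex
    rw [Finset.sum_eq_single_of_mem k hk fun j hj hjk =>
      by_contra fun hj0 => hjk (huniq j hj k hk hj0 hk0)]
    exact hf k hk
  · push Not at hex
    rwa [Finset.sum_eq_zero hex, norm_zero]

/-- The time at which step `k` of the staircase of widths `w` is reached, when climbing from one
step to the next takes time `τ`. -/
noncomputable def arrivalTime (w : ℕ → ℝ) (τ : ℝ) (k : ℕ) : ℝ :=
  ∑ j ∈ Finset.range k, (w j + τ)

/-- A smooth function climbing from `0` to `N`, which rests at height `k` during a time `w k` and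
then climbs to height `k + 1` in time `τ`. -/
noncomputable def staircase (N : ℕ) (w : ℕ → ℝ) (τ t : ℝ) : ℝ :=
  ∑ k ∈ Finset.range N, Real.smoothTransition (τ⁻¹ * (t - (arrivalTime w τ k + w k)))

section Staircase

theorem arrivalTime_succ (w : ℕ → ℝ) (τ : ℝ) (k : ℕ) :
    arrivalTime w τ (k + 1) = arrivalTime w τ k + w k + τ := by
  rw [arrivalTime, Finset.sum_range_succ, ← arrivalTime, add_assoc]

theorem contDiff_staircase (N : ℕ) (w : ℕ → ℝ) (τ : ℝ) : ContDiff ℝ ∞ (staircase N w τ) :=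
  ContDiff.sum fun _ _ => (Real.smoothTransition.contDiff (n := ⊤)).comp (by fun_prop)

theorem iteratedDeriv_staircase (N : ℕ) (w : ℕ → ℝ) (τ : ℝ) (i : ℕ) (t : ℝ) :
    iteratedDeriv i (staircase N w τ) t = ∑ k ∈ Finset.range N,
      τ⁻¹ ^ i * iteratedDeriv i Real.smoothTransition (τ⁻¹ * (t - (arrivalTime w τ k + w k))) := by
  have hσ : ContDiff ℝ i Real.smoothTransition := Real.smoothTransition.contDiff (n := i)
  have hstep (k : ℕ) : ContDiff ℝ i fun t : ℝ =>
      Real.smoothTransition (τ⁻¹ * (t - (arrivalTime w τ k + w k))) := hσ.comp (by fun_prop)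
  unfold staircase
  rw [iteratedDeriv_fun_sum fun k _ => (hstep k).contDiffAt]
  refine Finset.sum_congr rfl fun k _ => ?_
  rw [congrFun (iteratedDeriv_comp_sub_const i
    (fun z => Real.smoothTransition (τ⁻¹ * z)) (arrivalTime w τ k + w k)) t,
    iteratedDeriv_comp_const_mul hσ]

variable {w : ℕ → ℝ} {τ : ℝ}

theorem monotone_arrivalTime (hw : ∀ k, 0 ≤ w k) (hτ : 0 ≤ τ) : Monotone (arrivalTime w τ) :=
  monotone_nat_of_le_succ fun k => by rw [arrivalTime_succ]; linarith [hw k]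

theorem staircase_eq_of_mem_Icc (hw : ∀ k, 0 ≤ w k) (hτ : 0 < τ) {N k : ℕ} (hk : k ≤ N) {t : ℝ}
    (ht : t ∈ Icc (arrivalTime w τ k) (arrivalTime w τ k + w k)) : staircase N w τ t = k := by
  have hmono := monotone_arrivalTime hw hτ.le
  have hpast {j : ℕ} (hj : j < k) : 1 ≤ τ⁻¹ * (t - (arrivalTime w τ j + w j)) := by
    have harr := hmono (Nat.succ_le_of_lt hj)
    rw [Nat.succ_eq_add_one, arrivalTime_succ] at harr
    rw [le_inv_mul_iff₀ hτ]
    linarith [ht.1]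
  have hfuture {j : ℕ} (hj : k ≤ j) : τ⁻¹ * (t - (arrivalTime w τ j + w j)) ≤ 0 := by
    refine mul_nonpos_of_nonneg_of_nonpos (inv_nonneg.2 hτ.le) ?_
    obtain rfl | hlt := hj.eq_or_lt
    · linarith [ht.2]
    · have harr := hmono (Nat.succ_le_of_lt hlt)
      rw [Nat.succ_eq_add_one, arrivalTime_succ] at harr
      linarith [ht.2, hw j]
  have hstep (j : ℕ) : Real.smoothTransition (τ⁻¹ * (t - (arrivalTime w τ j + w j))) =
      if j ∈ Finset.range k then 1 else 0 := by
    split_ifs with hj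
    · exact Real.smoothTransition.one_of_one_le (hpast (Finset.mem_range.1 hj))
    · exact Real.smoothTransition.zero_of_nonpos (hfuture (by simpa using hj))
  simp only [staircase, hstep]
  rw [Finset.sum_ite_mem, Finset.inter_eq_right.2 (Finset.range_subset_range.2 hk)]
  simp

theorem mem_Ioo_arrivalTime_of_iteratedDeriv_ne_zero (hw : ∀ k, 0 ≤ w k) (hτ : 0 < τ) {i k : ℕ}
    (hi : 1 ≤ i) {t : ℝ}
    (ht : iteratedDeriv i Real.smoothTransition (τ⁻¹ * (t - (arrivalTime w τ k + w k))) ≠ 0) :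
    t ∈ Ioo (arrivalTime w τ k) (arrivalTime w τ (k + 1)) := by
  obtain ⟨h0, h1⟩ := support_iteratedDeriv_smoothTransition_subset hi ht
  rw [inv_mul_lt_iff₀ hτ] at h1
  have h0' := pos_of_mul_pos_right h0 (inv_nonneg.2 hτ.le)
  rw [arrivalTime_succ]
  constructor <;> linarith [hw k]

theorem abs_iteratedDeriv_staircase_le (hw : ∀ k, 0 ≤ w k) (hτ : 0 < τ) {i : ℕ} (hi : 1 ≤ i)
    {C : ℝ} (hC : ∀ x, |iteratedDeriv i Real.smoothTransition x| ≤ C) (N : ℕ) (t : ℝ) :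
    |iteratedDeriv i (staircase N w τ) t| ≤ τ⁻¹ ^ i * C := by
  rw [iteratedDeriv_staircase, ← Finset.mul_sum, abs_mul, abs_of_nonneg (by positivity),
    ← Real.norm_eq_abs]
  refine mul_le_mul_of_nonneg_left ?_ (by positivity)
  refine norm_sum_le_of_unique_ne_zero ((abs_nonneg _).trans (hC 0)) (fun _ _ => hC _)
    fun j _ k _ hj hk => ?_
  by_contra hjk
  exact disjoint_left.1 ((monotone_arrivalTime hw hτ.le).pairwise_disjoint_on_Ioo_succ hjk)
    (mem_Ioo_arrivalTime_of_iteratedDeriv_ne_zero hw hτ hi hj)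
    (mem_Ioo_arrivalTime_of_iteratedDeriv_ne_zero hw hτ hi hk)

variable {E : Type*} [NormedAddCommGroup E] [NormedSpace ℝ E] {g : ℝ → E} {M : ℝ} {c : ℕ → E}

theorem norm_integral_arrivalTime_sub_sum_le [CompleteSpace E] (hw : ∀ k, 0 ≤ w k) (hτ : 0 ≤ τ)
    (hg : Continuous g) (hM : ∀ t, ‖g t‖ ≤ M) (N : ℕ)
    (hc : ∀ k < N, ∀ t ∈ Icc (arrivalTime w τ k) (arrivalTime w τ k + w k), g t = c k) :
    ‖(∫ t in (0 : ℝ)..arrivalTime w τ N, g t) - ∑ k ∈ Finset.range N, w k • c k‖ ≤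
      N * τ * M := by
  induction N with
  | zero => simp [arrivalTime]
  | succ N ih =>
    set a := arrivalTime w τ N
    have hint (x y : ℝ) : IntervalIntegrable g volume x y := hg.intervalIntegrable x y
    have hrest : ∫ t in a..(a + w N), g t = w N • c N := by
      rw [intervalIntegral.integral_congr (g := fun _ => c N)]
      · simp
      · rw [uIcc_of_le (by linarith [hw N])]
        exact hc N (Nat.lt_succ_self N)
    have hclimb : ‖∫ t in (a + w N)..(a + w N + τ), g t‖ ≤ M * τ := by
      simpa [abs_of_nonneg hτ] using intervalIntegral.norm_integral_le_of_norm_le_const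
        (a := a + w N) (b := a + w N + τ) fun t _ => hM t
    calc ‖(∫ t in (0 : ℝ)..arrivalTime w τ (N + 1), g t) - ∑ k ∈ Finset.range (N + 1), w k • c k‖
        = ‖((∫ t in (0 : ℝ)..a, g t) - ∑ k ∈ Finset.range N, w k • c k) +
            ∫ t in (a + w N)..(a + w N + τ), g t‖ := by
          rw [arrivalTime_succ,
            ← intervalIntegral.integral_add_adjacent_intervals (hint 0 (a + w N)) (hint _ _),
            ← intervalIntegral.integral_add_adjacent_intervals (hint 0 a) (hint _ _), hrest,
            Finset.sum_range_succ]
          congr 1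
          abel
      _ ≤ N * τ * M + M * τ :=
          norm_add_le_of_le (ih fun k hk => hc k (hk.trans N.lt_succ_self)) hclimb
      _ = (N + 1 : ℕ) * τ * M := by push_cast; ring

theorem norm_average_sub_sum_smul_le [CompleteSpace E] {N : ℕ} {T : ℝ} {P : ℕ → ℝ}
    (hP : ∀ k, 0 ≤ P k) (hP1 : ∑ k ∈ Finset.range N, P k = 1) (hT : 0 < T) (hτ : 0 ≤ τ)
    (hτT : N * τ ≤ T) (hg : Continuous g) (hM : ∀ t, ‖g t‖ ≤ M)
    (hw : ∀ k, w k = (T - N * τ) * P k)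
    (hc : ∀ k < N, ∀ t ∈ Icc (arrivalTime w τ k) (arrivalTime w τ k + w k), g t = c k) :
    ‖T⁻¹ • (∫ t in (0 : ℝ)..T, g t) - ∑ k ∈ Finset.range N, P k • c k‖ ≤
      2 * M * (N * τ / T) := by
  have hw0 (k : ℕ) : 0 ≤ w k := by rw [hw]; exact mul_nonneg (sub_nonneg.2 hτT) (hP k)
  have hend : arrivalTime w τ N = T := by
    simp only [arrivalTime, hw, Finset.sum_add_distrib, ← Finset.mul_sum, hP1, Finset.sum_const,
      Finset.card_range, nsmul_eq_mul]
    ring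
  have hcM {k : ℕ} (hk : k < N) : ‖c k‖ ≤ M := by
    rw [← hc k hk _ ⟨le_rfl, by linarith [hw0 k]⟩]
    exact hM _
  have hsum : ‖∑ k ∈ Finset.range N, P k • c k‖ ≤ M := by
    refine (norm_sum_le_of_le _ fun k hk => (norm_smul_le _ _).trans
      (mul_le_mul_of_nonneg_left (hcM (Finset.mem_range.1 hk)) (norm_nonneg _))).trans_eq ?_
    simp only [Real.norm_of_nonneg (hP _), ← Finset.sum_mul, hP1, one_mul]
  have hint := norm_integral_arrivalTime_sub_sum_le hw0 hτ hg hM N hc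
  simp only [hend, hw, mul_smul, ← Finset.smul_sum] at hint
  set I := ∫ t in (0 : ℝ)..T, g t
  set S := ∑ k ∈ Finset.range N, P k • c k
  calc ‖T⁻¹ • I - S‖ = ‖T⁻¹ • (I - (T - N * τ) • S) - (N * τ / T) • S‖ := by
        congr 1
        match_scalars
        · ring
        · field_simp
          ring
    _ ≤ T⁻¹ * (N * τ * M) + N * τ / T * M := by
        refine norm_sub_le_of_le ?_ ?_
        · rw [norm_smul, Real.norm_of_nonneg (by positivity)]
          exact mul_le_mul_of_nonneg_left hint (by positivity)
        · rw [norm_smul, Real.norm_of_nonneg (by positivity)]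
          exact mul_le_mul_of_nonneg_left hsum (by positivity)
    _ = 2 * M * (N * τ / T) := by ring

end Staircase

/-! ### A net of the torus along a line -/

theorem exists_lt_norm_coe_sub_le {n : ℕ} (hn : 0 < n) {s : ℝ} (hs₀ : 0 ≤ s)
    (hs : s ≤ (n : ℝ)⁻¹) (u : UnitAddCircle) :
    ∃ a < n, ‖((a * (n : ℝ)⁻¹ + s : ℝ) : UnitAddCircle) - u‖ ≤ (n : ℝ)⁻¹ := by
  have hn₀ : (0 : ℝ) < n := Nat.cast_pos.2 hn
  obtain ⟨x, ⟨hx₀, hx₁⟩, rfl⟩ := AddCircle.eq_coe_Ico u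
  have hfloor_le : ⌊n * x⌋₊ * (n : ℝ)⁻¹ ≤ x := by
    rw [← div_eq_mul_inv, div_le_iff₀ hn₀, mul_comm x]
    exact Nat.floor_le (by positivity)
  have hlt_floor : x < (⌊n * x⌋₊ + 1) * (n : ℝ)⁻¹ := by
    rw [← div_eq_mul_inv, lt_div_iff₀ hn₀, mul_comm x]
    exact Nat.lt_floor_add_one _
  refine ⟨⌊n * x⌋₊, (Nat.floor_lt (by positivity)).2 (by nlinarith), ?_⟩
  rw [← AddCircle.coe_sub]
  refine QuotientAddGroup.norm_mk_le_norm.trans (abs_le.2 ⟨?_, ?_⟩) <;> linarith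

/-- The points `k • (n⁻¹, n⁻², …)` are numbered in base `n`: the top digit of `k` steers the last
coordinate, and it moves the other coordinates by integers. -/
theorem exists_lt_pow_norm_coe_sub_le {n : ℕ} (hn : 0 < n) (d : ℕ) (y : Fin d → UnitAddCircle) :
    ∃ k < n ^ d, ∀ i : Fin d,
      ‖((k * (n : ℝ)⁻¹ ^ (i + 1 : ℕ) : ℝ) : UnitAddCircle) - y i‖ ≤ (n : ℝ)⁻¹ := by
  have hn₀ : (0 : ℝ) < n := Nat.cast_pos.2 hn
  induction d with
  | zero => exact ⟨0, by simp, fun i => i.elim0⟩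
  | succ d ih =>
    obtain ⟨k, hk, hkd⟩ := ih fun i => y i.castSucc
    have hk_le : k * (n : ℝ)⁻¹ ^ (d + 1) ≤ (n : ℝ)⁻¹ := by
      have hk' : (k : ℝ) * (n : ℝ)⁻¹ ^ d ≤ 1 := by
        rw [inv_pow, ← div_eq_mul_inv, div_le_one (by positivity)]
        exact_mod_cast hk.le
      rw [pow_succ, ← mul_assoc]
      exact mul_le_of_le_one_left (by positivity) hk'
    obtain ⟨a, ha, had⟩ := exists_lt_norm_coe_sub_le hn (by positivity) hk_le (y (Fin.last d))
    refine ⟨k + a * n ^ d, ?_, fun i => ?_⟩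
    · calc k + a * n ^ d < (a + 1) * n ^ d := by rw [add_one_mul, add_comm]; gcongr
        _ ≤ n * n ^ d := Nat.mul_le_mul_right _ ha
        _ = n ^ (d + 1) := (pow_succ' n d).symm
    · induction i using Fin.lastCases with
      | last =>
        have hdigit : (n : ℝ) ^ d * (n : ℝ)⁻¹ ^ (d + 1) = (n : ℝ)⁻¹ := by
          rw [pow_succ, ← mul_assoc, ← mul_pow, mul_inv_cancel₀ hn₀.ne', one_pow, one_mul]
        convert had using 4
        rw [Fin.val_last]
        push_cast
        linear_combination (a : ℝ) * hdigit
      | cast i =>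
        convert hkd i using 3
        have hsplit : ((k + a * n ^ d : ℕ) : ℝ) * (n : ℝ)⁻¹ ^ (i + 1 : ℕ) =
            k * (n : ℝ)⁻¹ ^ (i + 1 : ℕ) + ((a * n ^ (d - (i + 1)) : ℕ) : ℤ) := by
          push_cast
          rw [add_mul, mul_assoc, pow_sub₀ _ hn₀.ne' i.is_lt, inv_pow]
        have hint : (((a * n ^ (d - (i + 1)) : ℕ) : ℤ) : ℝ) = (0 : UnitAddCircle) :=
          (AddCircle.coe_eq_zero_iff 1).2 ⟨_, zsmul_one _⟩
        rw [Fin.val_castSucc, hsplit, AddCircle.coe_add, hint, add_zero]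

/-- The direction `(n⁻¹, n⁻², …, n⁻ᵈ)` of a line through the origin of the torus whose points with
integer parameter in `[0, nᵈ)` form an `n⁻¹`-net. -/
noncomputable def lineDirection (d n : ℕ) : EuclideanSpace ℝ (Fin d) :=
  WithLp.toLp 2 fun i => (n : ℝ)⁻¹ ^ (i + 1 : ℕ)

theorem norm_lineDirection_le (d n : ℕ) : ‖lineDirection d n‖ ≤ d * (n : ℝ)⁻¹ := by
  have hcoord (i : Fin d) : ‖lineDirection d n i‖ ≤ (n : ℝ)⁻¹ := by
    rw [lineDirection, Real.norm_of_nonneg (by positivity)]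
    exact pow_le_of_le_one (by positivity) (Nat.cast_inv_le_one n) (Nat.succ_ne_zero _)
  rw [EuclideanSpace.norm_eq]
  refine Real.sqrt_le_iff.2 ⟨by positivity, ?_⟩
  calc ∑ i, ‖lineDirection d n i‖ ^ 2 ≤ ∑ _i : Fin d, (n : ℝ)⁻¹ ^ 2 := by
        gcongr with i
        exact hcoord i
    _ = d * (n : ℝ)⁻¹ ^ 2 := by simp
    _ ≤ (d * (n : ℝ)⁻¹) ^ 2 := by
        rw [mul_pow]
        gcongr
        exact_mod_cast Nat.le_self_pow two_ne_zero d

theorem exists_dist_torusProj_smul_lineDirection_le {d n : ℕ} (hn : 0 < n)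
    (y : UnitAddTorus (Fin d)) :
    ∃ k < n ^ d, dist (torusProj ((k : ℝ) • lineDirection d n)) y ≤ (n : ℝ)⁻¹ := by
  obtain ⟨k, hk, hkd⟩ := exists_lt_pow_norm_coe_sub_le hn d y
  refine ⟨k, hk, (dist_pi_le_iff (by positivity)).2 fun i => ?_⟩
  rw [dist_eq_norm]
  exact hkd i

/-! ### Curve measures close to a given measure -/

theorem integral_comp_eq_sum_of_lt {X E : Type*} [MeasurableSpace X] [NormedAddCommGroup E]
    [NormedSpace ℝ E] [CompleteSpace E] (μ : Measure X) [IsFiniteMeasure μ] {ind : X → ℕ}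
    (hind : Measurable ind) {N : ℕ} (hN : ∀ y, ind y < N) (c : ℕ → E) :
    ∫ y, c (ind y) ∂μ = ∑ k ∈ Finset.range N, (μ.map ind).real {k} • c k := by
  have hrange : ∀ᵐ k ∂μ.map ind, k ∈ (Finset.range N : Set ℕ) :=
    (ae_map_iff hind.aemeasurable MeasurableSet.of_discrete).2
      (Eventually.of_forall fun y => by simpa using hN y)
  have hset := setIntegral_finset (μ := μ.map ind) (Finset.range N) (IntegrableOn.finset (f := c))
  rwa [Measure.restrict_eq_self_of_ae_mem hrange,
    integral_map hind.aemeasurable .of_discrete] at hset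

theorem exists_sum_smul_close_integral {X E : Type*} [PseudoMetricSpace X] [MeasurableSpace X]
    [OpensMeasurableSpace X] [NormedAddCommGroup E] [NormedSpace ℝ E] [CompleteSpace E]
    (μ : Measure X) [IsProbabilityMeasure μ] {x : ℕ → X} {N : ℕ} {δ : ℝ}
    (hx : ∀ y, ∃ k < N, dist (x k) y ≤ δ) :
    ∃ P : ℕ → ℝ, (∀ k, 0 ≤ P k) ∧ ∑ k ∈ Finset.range N, P k = 1 ∧
      ∀ (f : X → E) (K : NNReal), LipschitzWith K f → Integrable f μ →
        ‖∑ k ∈ Finset.range N, P k • f (x k) - ∫ y, f y ∂μ‖ ≤ K * δ := by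
  obtain ⟨y₀⟩ := μ.nonempty_of_neZero
  obtain ⟨k₀, hk₀, -⟩ := hx y₀
  set ind : SimpleFunc X ℕ := SimpleFunc.nearestPtInd x (N - 1)
  have hind_lt (y : X) : ind y < N := by
    have hle : ind y ≤ N - 1 := SimpleFunc.nearestPtInd_le x (N - 1) y
    omega
  have hdist (y : X) : dist (x (ind y)) y ≤ δ := by
    obtain ⟨k, hk, hky⟩ := hx y
    have hnearest : edist (x (ind y)) y ≤ edist (x k) y :=
      SimpleFunc.edist_nearestPt_le x y (Nat.le_sub_one_of_lt hk)
    rw [edist_dist, edist_dist, ENNReal.ofReal_le_ofReal_iff dist_nonneg] at hnearest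
    exact hnearest.trans hky
  refine ⟨fun k => (μ.map ind).real {k}, fun k => measureReal_nonneg, ?_, fun f K hf hfint => ?_⟩
  · simpa using (integral_comp_eq_sum_of_lt μ ind.measurable hind_lt fun _ => (1 : ℝ)).symm
  · have hind_int : Integrable (fun y => f (x (ind y))) μ :=
      (ind.map (f ∘ x)).integrable_of_isFiniteMeasure
    have hclose (y : X) : ‖f (x (ind y)) - f y‖ ≤ K * δ := by
      rw [← dist_eq_norm]
      exact (hf.dist_le_mul _ _).trans (mul_le_mul_of_nonneg_left (hdist y) K.2)
    rw [← integral_comp_eq_sum_of_lt μ ind.measurable hind_lt fun k => f (x k),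
      ← integral_sub hind_int hfint]
    simpa using norm_integral_le_of_norm_le_const (μ := μ) (Eventually.of_forall hclose)

theorem integral_cond_Icc {E : Type*} [NormedAddCommGroup E] [NormedSpace ℝ E] {a b : ℝ}
    (hab : a ≤ b) (f : ℝ → E) :
    ∫ t, f t ∂ProbabilityTheory.cond volume (Icc a b) = (b - a)⁻¹ • ∫ t in a..b, f t := by
  rw [ProbabilityTheory.cond, integral_smul_measure, Real.volume_Icc, ENNReal.toReal_inv,
    ENNReal.toReal_ofReal (sub_nonneg.2 hab), intervalIntegral.integral_of_le hab,
    integral_Icc_eq_integral_Ioc]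

theorem mul_le_pow_mul_rpow_inv {c ρ : ℝ} (hc : 1 ≤ c) (hρ₀ : 0 < ρ) (hρ₁ : ρ ≤ 1) {i m : ℕ}
    (hi : 1 ≤ i) (him : i ≤ m) : c * ρ ≤ (c * ρ ^ (m : ℝ)⁻¹) ^ i := by
  have hm : (0 : ℝ) < m := by exact_mod_cast hi.trans him
  rw [mul_pow]
  refine mul_le_mul (le_self_pow₀ hc (by omega)) ?_ hρ₀.le (by positivity)
  rw [← Real.rpow_mul_natCast hρ₀.le]
  nth_rewrite 1 [← Real.rpow_one ρ]
  refine Real.rpow_le_rpow_of_exponent_ge hρ₀ hρ₁ ?_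
  rw [inv_mul_le_iff₀ hm, mul_one]
  exact_mod_cast him

section CurveMeasures

variable {d m : ℕ} {α : ℕ → ℝ}

/-- A displacement of length `ρ` from rest to rest takes a time of order `ρ ^ (1 / m)`, the bound on
the `m`-th derivative being the most restrictive one. -/
theorem exists_staircase_smul_mem_admissibleCurves (hα : ∀ i, 1 ≤ i → i ≤ m → 0 < α i) (D : ℝ) :
    ∃ c : ℝ, 1 ≤ c ∧ ∀ ρ, 0 < ρ → ρ ≤ 1 → ∀ v : EuclideanSpace ℝ (Fin d), ‖v‖ ≤ D * ρ →
      ∀ (N : ℕ) (w : ℕ → ℝ), (∀ k, 0 ≤ w k) → ∀ T : ℝ,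
        (torusProj ∘ fun t => staircase N w (c * ρ ^ (m : ℝ)⁻¹) t • v) ∈
          admissibleCurves d m α T := by
  choose! C hC using fun i (hi : 1 ≤ i) => exists_bound_iteratedDeriv_smoothTransition hi
  obtain ⟨c, hc, hc₁⟩ : ∃ c, (∀ i ∈ Finset.Icc 1 m, C i * D / α i ≤ c) ∧ 1 ≤ c :=
    (((Finset.Icc 1 m).eventually_all.2 fun i _ => eventually_ge_atTop _).and
      (eventually_ge_atTop 1)).exists
  refine ⟨c, hc₁, fun ρ hρ₀ hρ₁ v hv N w hw T => ?_⟩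
  set τ := c * ρ ^ (m : ℝ)⁻¹
  have hτ : 0 < τ := by positivity
  have hs : ContDiff ℝ m (staircase N w τ) :=
    (contDiff_staircase N w τ).of_le (by exact_mod_cast le_top)
  refine torusProj_comp_mem_admissibleCurves (hs.smul contDiff_const) (fun i hi him t => ?_) T
  have hCi : 0 ≤ C i := (abs_nonneg _).trans (hC i hi 0)
  have hspeed : C i * D * ρ ≤ α i * τ ^ i := by
    have hci := (div_le_iff₀ (hα i hi him)).1 (hc i (Finset.mem_Icc.2 ⟨hi, him⟩))
    calc C i * D * ρ ≤ c * α i * ρ := by gcongr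
      _ = α i * (c * ρ) := by ring
      _ ≤ α i * τ ^ i :=
          mul_le_mul_of_nonneg_left (mul_le_pow_mul_rpow_inv hc₁ hρ₀ hρ₁ hi him) (hα i hi him).le
  rw [Pi.smul_def', iteratedDeriv_smul_const (hs.of_le (by exact_mod_cast him)).contDiffAt,
    norm_smul, Real.norm_eq_abs]
  calc |iteratedDeriv i (staircase N w τ) t| * ‖v‖ ≤ τ⁻¹ ^ i * C i * (D * ρ) :=
        mul_le_mul (abs_iteratedDeriv_staircase_le hw hτ hi (hC i hi) N t) hv (norm_nonneg _)
          (by positivity)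
    _ = C i * D * ρ / τ ^ i := by rw [inv_pow, div_eq_mul_inv]; ring
    _ ≤ α i := (div_le_iff₀ (by positivity)).2 hspeed

variable {E : Type*} [NormedAddCommGroup E] [NormedSpace ℝ E] [CompleteSpace E]

theorem exists_curveMeasure_close_sum_smul {N : ℕ} {τ T : ℝ} (hτ : 0 < τ) (hT : 0 < T)
    (hτT : N * τ ≤ T) {v : EuclideanSpace ℝ (Fin d)}
    (hv : ∀ w : ℕ → ℝ, (∀ k, 0 ≤ w k) →
      (torusProj ∘ fun t => staircase N w τ t • v) ∈ admissibleCurves d m α T)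
    {P : ℕ → ℝ} (hP : ∀ k, 0 ≤ P k) (hP1 : ∑ k ∈ Finset.range N, P k = 1) :
    ∃ ν ∈ curveMeasures d m α T, ∀ (f : UnitAddTorus (Fin d) → E) (M : ℝ), Continuous f →
      (∀ x, ‖f x‖ ≤ M) →
        ‖(∫ y, f y ∂(ν : Measure (UnitAddTorus (Fin d)))) -
          ∑ k ∈ Finset.range N, P k • f (torusProj ((k : ℝ) • v))‖ ≤ 2 * M * (N * τ / T) := by
  set w : ℕ → ℝ := fun k => (T - N * τ) * P k
  have hw (k : ℕ) : 0 ≤ w k := mul_nonneg (sub_nonneg.2 hτT) (hP k)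
  set p : ℝ → UnitAddTorus (Fin d) := torusProj ∘ fun t => staircase N w τ t • v
  have hp : Continuous p :=
    continuous_torusProj.comp ((contDiff_staircase N w τ).continuous.smul continuous_const)
  have hprob : IsProbabilityMeasure (ProbabilityTheory.cond volume (Icc 0 T)) :=
    ProbabilityTheory.cond_isProbabilityMeasure_of_finite (by simp [hT]) (by simp)
  refine ⟨⟨_, Measure.isProbabilityMeasure_map hp.aemeasurable⟩, ⟨p, hv w hw, rfl⟩,
    fun f M hf hM => ?_⟩
  rw [ProbabilityMeasure.coe_mk, integral_map hp.aemeasurable hf.aestronglyMeasurable,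
    integral_cond_Icc hT.le, sub_zero]
  refine norm_average_sub_sum_smul_le hP hP1 hT hτ.le hτT (hf.comp hp) (fun t => hM _)
    (fun k => rfl) fun k hk t ht => ?_
  simp only [p, Function.comp_apply, staircase_eq_of_mem_Icc hw hτ hk.le ht]

theorem exists_curveMeasure_close (hα : ∀ i, 1 ≤ i → i ≤ m → 0 < α i)
    (π : ProbabilityMeasure (UnitAddTorus (Fin d))) :
    ∃ c : ℝ, 1 ≤ c ∧ ∀ n : ℕ, c ≤ n → ∀ T : ℝ, (n : ℝ) ^ (d + 1 - (m : ℝ)⁻¹) ≤ T →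
      ∃ ν ∈ curveMeasures d m α T, ∀ (f : UnitAddTorus (Fin d) → E) (K : NNReal) (M : ℝ),
        LipschitzWith K f → (∀ x, ‖f x‖ ≤ M) →
          ‖(∫ y, f y ∂(ν : Measure (UnitAddTorus (Fin d)))) -
            ∫ y, f y ∂(π : Measure (UnitAddTorus (Fin d)))‖ ≤ (K + 2 * M * c) * (n : ℝ)⁻¹ := by
  obtain ⟨c, hc₁, hc⟩ := exists_staircase_smul_mem_admissibleCurves (d := d) hα d
  refine ⟨c, hc₁, fun n hn T hT => ?_⟩
  have hn₁ : (1 : ℝ) ≤ n := hc₁.trans hn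
  have hn₀ : (0 : ℝ) < n := by linarith
  have hT₀ : 0 < T := (Real.rpow_pos_of_pos hn₀ _).trans_le hT
  set τ := c * (n : ℝ)⁻¹ ^ (m : ℝ)⁻¹
  have hfrac : (n ^ d : ℕ) * τ / T ≤ c * (n : ℝ)⁻¹ := by
    rw [div_le_iff₀ hT₀]
    calc (n ^ d : ℕ) * τ = c * (n : ℝ)⁻¹ * (n : ℝ) ^ (d + 1 - (m : ℝ)⁻¹) := by
          rw [Real.rpow_sub hn₀, Real.rpow_add hn₀, Real.rpow_natCast, Real.rpow_one]
          simp only [τ, Real.inv_rpow hn₀.le]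
          push_cast
          field_simp
      _ ≤ c * (n : ℝ)⁻¹ * T := by gcongr
  have hτT : (n ^ d : ℕ) * τ ≤ T := by
    rw [← div_le_one hT₀]
    exact hfrac.trans ((mul_inv_le_iff₀ hn₀).2 (by rwa [one_mul]))
  obtain ⟨P, hP, hP1, hquant⟩ := exists_sum_smul_close_integral (E := E)
    (π : Measure (UnitAddTorus (Fin d)))
    (exists_dist_torusProj_smul_lineDirection_le (d := d) (Nat.cast_pos.1 hn₀))
  obtain ⟨ν, hν, hcurve⟩ := exists_curveMeasure_close_sum_smul (E := E) (by positivity) hT₀ hτT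
    (fun w hw => hc _ (inv_pos.2 hn₀) (inv_le_one_of_one_le₀ hn₁) _ (norm_lineDirection_le d n) _ w
      hw T) hP hP1
  refine ⟨ν, hν, fun f K M hf hM => ?_⟩
  have hM₀ : 0 ≤ M := (norm_nonneg _).trans (hM 0)
  have hint : Integrable f (π : Measure (UnitAddTorus (Fin d))) :=
    hf.continuous.integrable_of_hasCompactSupport (.of_compactSpace f)
  calc _ ≤ 2 * M * ((n ^ d : ℕ) * τ / T) + K * (n : ℝ)⁻¹ :=
        norm_sub_le_norm_sub_add_norm_sub _ _ _ |>.trans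
          (add_le_add (hcurve f M hf.continuous hM) (hquant f K hf hint))
    _ ≤ 2 * M * (c * (n : ℝ)⁻¹) + K * (n : ℝ)⁻¹ := by gcongr
    _ = (K + 2 * M * c) * (n : ℝ)⁻¹ := by ring

end CurveMeasures

/-! ### Kernel norm and Fourier coefficients -/

instance (d : ℕ) : IsProbabilityMeasure (torusVolume d) := by
  unfold torusVolume; infer_instance

instance (d : ℕ) : (torusVolume d).IsAddHaarMeasure := by
  unfold torusVolume; infer_instance

section KernelNorm

variable {d : ℕ} {h : UnitAddTorus (Fin d) → ℝ}

theorem conv_diffMeasure (hh : Continuous h) (μ π : ProbabilityMeasure (UnitAddTorus (Fin d)))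
    (x : UnitAddTorus (Fin d)) :
    conv h (diffMeasure μ π) x = (∫ y, h (x - y) ∂(μ : Measure (UnitAddTorus (Fin d)))) -
      ∫ y, h (x - y) ∂(π : Measure (UnitAddTorus (Fin d))) := by
  have hint (ν : ProbabilityMeasure (UnitAddTorus (Fin d))) :
      (ν : Measure (UnitAddTorus (Fin d))).toSignedMeasure.Integrable fun y => h (x - y) := by
    rw [VectorMeasure.Integrable, Measure.variation_toSignedMeasure]
    exact (by fun_prop : Continuous fun y => h (x - y)).integrable_of_hasCompactSupport
      (.of_compactSpace _)
  rw [conv, diffMeasure, VectorMeasure.integral_sub_vectorMeasure (hint μ) (hint π),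
    VectorMeasure.integral_toSignedMeasure, VectorMeasure.integral_toSignedMeasure]

theorem kernelNorm_le {ν : SignedMeasure (UnitAddTorus (Fin d))} {B : ℝ}
    (hB : ∀ x, |conv h ν x| ≤ B) : kernelNorm h ν ≤ B := by
  have hB₀ : 0 ≤ B := (abs_nonneg _).trans (hB 0)
  refine Real.sqrt_le_iff.2 ⟨hB₀, ?_⟩
  calc ∫ x, (conv h ν x) ^ 2 ∂(torusVolume d) ≤ ∫ _x, B ^ 2 ∂(torusVolume d) :=
        integral_mono_of_nonneg (Eventually.of_forall fun x => sq_nonneg _) (integrable_const _)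
          (Eventually.of_forall fun x => sq_le_sq' (neg_le_of_abs_le (hB x)) (le_of_abs_le (hB x)))
    _ = B ^ 2 := by simp

theorem kernelNorm_nonneg (h : UnitAddTorus (Fin d) → ℝ)
    (ν : SignedMeasure (UnitAddTorus (Fin d))) : 0 ≤ kernelNorm h ν :=
  Real.sqrt_nonneg _

theorem continuous_integral_comp_sub {G E : Type*} [AddGroup G] [TopologicalSpace G]
    [IsTopologicalAddGroup G] [CompactSpace G] [SecondCountableTopology G] [MeasurableSpace G]
    [OpensMeasurableSpace G] [NormedAddCommGroup E] [NormedSpace ℝ E] {f : G → E}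
    (hf : Continuous f) (μ : Measure G) [IsFiniteMeasure μ] :
    Continuous fun x => ∫ y, f (x - y) ∂μ := by
  simpa using continuous_parametric_integral_of_continuous (μ := μ) (f := fun x y => f (x - y))
    (hf.comp continuous_sub) isCompact_univ

theorem continuous_conv_diffMeasure (hh : Continuous h)
    (μ π : ProbabilityMeasure (UnitAddTorus (Fin d))) :
    Continuous (conv h (diffMeasure μ π)) := by
  rw [funext (conv_diffMeasure hh μ π)]
  exact (continuous_integral_comp_sub hh _).sub (continuous_integral_comp_sub hh _)

theorem integral_abs_conv_le_kernelNorm {ν : SignedMeasure (UnitAddTorus (Fin d))}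
    (hν : Continuous (conv h ν)) : ∫ x, |conv h ν x| ∂(torusVolume d) ≤ kernelNorm h ν := by
  refine Real.le_sqrt_of_sq_le ?_
  simpa only [sq_abs, Function.comp_apply] using
    (even_two.convexOn_pow (𝕜 := ℝ)).map_integral_le (μ := torusVolume d)
      (continuous_pow 2).continuousOn isClosed_univ (Eventually.of_forall fun x => mem_univ _)
      (hν.abs.integrable_of_hasCompactSupport (.of_compactSpace _))
      ((hν.abs.pow 2).integrable_of_hasCompactSupport (.of_compactSpace _))

end KernelNorm

section Fourier

open UnitAddTorus

theorem mFourier_apply_add {ι : Type*} [Fintype ι] (n : ι → ℤ) (x y : UnitAddTorus ι) :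
    mFourier n (x + y) = mFourier n x * mFourier n y := by
  simp only [mFourier, ContinuousMap.coe_mk, ← Finset.prod_mul_distrib, fourier_apply,
    Pi.add_apply, smul_add, AddCircle.toCircle_add, Circle.coe_mul]

theorem norm_mFourier_apply {ι : Type*} [Fintype ι] (n : ι → ℤ) (x : UnitAddTorus ι) :
    ‖mFourier n x‖ = 1 := by
  simp only [mFourier, ContinuousMap.coe_mk, fourier_apply, norm_prod, Circle.norm_coe,
    Finset.prod_const_one]

/-- The Fourier–Stieltjes coefficient `μ̂(n)`, the analogue for a measure of
`UnitAddTorus.mFourierCoeff`. -/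
noncomputable def fourierStieltjesCoeff {ι : Type*} [Fintype ι] (μ : Measure (UnitAddTorus ι))
    (n : ι → ℤ) : ℂ :=
  ∫ y, mFourier (-n) y ∂μ

variable {d : ℕ}

theorem mFourierCoeff_eq_integral_torusVolume (f : UnitAddTorus (Fin d) → ℂ) (n : Fin d → ℤ) :
    mFourierCoeff f n = ∫ x, mFourier (-n) x * f x ∂(torusVolume d) :=
  rfl

theorem norm_mFourierCoeff_le_integral_norm (f : UnitAddTorus (Fin d) → ℂ) (n : Fin d → ℤ) :
    ‖mFourierCoeff f n‖ ≤ ∫ x, ‖f x‖ ∂(torusVolume d) := by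
  rw [mFourierCoeff_eq_integral_torusVolume]
  simpa only [norm_mul, norm_mFourier_apply, one_mul] using
    norm_integral_le_integral_norm (μ := torusVolume d) fun x => mFourier (-n) x * f x

theorem mFourierCoeff_integral_comp_sub {f : UnitAddTorus (Fin d) → ℂ} (hf : Continuous f)
    (μ : Measure (UnitAddTorus (Fin d))) [IsFiniteMeasure μ] (n : Fin d → ℤ) :
    mFourierCoeff (fun x => ∫ y, f (x - y) ∂μ) n =
      mFourierCoeff f n * fourierStieltjesCoeff μ n := by
  have htranslate (y : UnitAddTorus (Fin d)) :
      ∫ x, mFourier (-n) x * f (x - y) ∂(torusVolume d) =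
        mFourierCoeff f n * mFourier (-n) y := by
    rw [← integral_add_right_eq_self (μ := torusVolume d) _ y,
      mFourierCoeff_eq_integral_torusVolume, ← integral_mul_const]
    simp only [add_sub_cancel_right, mFourier_apply_add, mul_right_comm]
  have hcont : Continuous fun z : UnitAddTorus (Fin d) × UnitAddTorus (Fin d) =>
      mFourier (-n) z.1 * f (z.1 - z.2) := by fun_prop
  calc mFourierCoeff (fun x => ∫ y, f (x - y) ∂μ) n
      = ∫ x, ∫ y, mFourier (-n) x * f (x - y) ∂μ ∂(torusVolume d) := by
        simp only [mFourierCoeff_eq_integral_torusVolume, integral_const_mul]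
    _ = ∫ y, ∫ x, mFourier (-n) x * f (x - y) ∂(torusVolume d) ∂μ :=
        integral_integral_swap (hcont.integrable_of_hasCompactSupport (.of_compactSpace _))
    _ = mFourierCoeff f n * fourierStieltjesCoeff μ n := by
        simp only [htranslate, integral_const_mul, fourierStieltjesCoeff]

theorem mFourierCoeff_conv_diffMeasure {h : UnitAddTorus (Fin d) → ℝ} (hh : Continuous h)
    (μ π : ProbabilityMeasure (UnitAddTorus (Fin d))) (n : Fin d → ℤ) :
    mFourierCoeff (fun x => (conv h (diffMeasure μ π) x : ℂ)) n =
      mFourierCoeff (fun x => (h x : ℂ)) n *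
        (fourierStieltjesCoeff (μ : Measure (UnitAddTorus (Fin d))) n -
          fourierStieltjesCoeff (π : Measure (UnitAddTorus (Fin d))) n) := by
  have hhC : Continuous fun x => (h x : ℂ) := Complex.continuous_ofReal.comp hh
  have hint (ν : ProbabilityMeasure (UnitAddTorus (Fin d))) :
      Integrable (fun x => mFourier (-n) x *
        ∫ y, (h (x - y) : ℂ) ∂(ν : Measure (UnitAddTorus (Fin d)))) (torusVolume d) :=
    ((mFourier (-n)).continuous.mul
      (continuous_integral_comp_sub hhC _)).integrable_of_hasCompactSupport (.of_compactSpace _)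
  rw [mul_sub, ← mFourierCoeff_integral_comp_sub hhC, ← mFourierCoeff_integral_comp_sub hhC]
  simp only [mFourierCoeff_eq_integral_torusVolume]
  rw [← integral_sub (hint μ) (hint π)]
  simp only [conv_diffMeasure hh, Complex.ofReal_sub, mul_sub, integral_complex_ofReal]

theorem norm_mFourierCoeff_mul_le_kernelNorm {h : UnitAddTorus (Fin d) → ℝ} (hh : Continuous h)
    (μ π : ProbabilityMeasure (UnitAddTorus (Fin d))) (n : Fin d → ℤ) :
    ‖mFourierCoeff (fun x => (h x : ℂ)) n‖ *
      ‖fourierStieltjesCoeff (μ : Measure (UnitAddTorus (Fin d))) n -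
        fourierStieltjesCoeff (π : Measure (UnitAddTorus (Fin d))) n‖ ≤
      kernelNorm h (diffMeasure μ π) := by
  rw [← norm_mul, ← mFourierCoeff_conv_diffMeasure hh]
  refine (norm_mFourierCoeff_le_integral_norm _ n).trans ?_
  simpa only [Complex.norm_real, Real.norm_eq_abs] using
    integral_abs_conv_le_kernelNorm (continuous_conv_diffMeasure hh μ π)

end Fourier

theorem tendsto_of_span_topologicalClosure_eq_top {X ι : Type*} (𝕜 : Type*) [RCLike 𝕜]
    [TopologicalSpace X] [CompactSpace X] [MeasurableSpace X] [OpensMeasurableSpace X]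
    {l : Filter ι} {μ : ι → ProbabilityMeasure X} {π : ProbabilityMeasure X} {S : Set C(X, 𝕜)}
    (hS : (Submodule.span 𝕜 S).topologicalClosure = ⊤)
    (hμ : ∀ f ∈ S, Tendsto (fun s => ∫ x, f x ∂(μ s : Measure X)) l
      (𝓝 (∫ x, f x ∂(π : Measure X)))) :
    Tendsto μ l (𝓝 π) := by
  have hint (ν : ProbabilityMeasure X) (f : C(X, 𝕜)) : Integrable f (ν : Measure X) :=
    f.continuous.integrable_of_hasCompactSupport (.of_compactSpace _)
  have hlip (ν : ProbabilityMeasure X) :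
      LipschitzWith 1 fun f : C(X, 𝕜) => ∫ x, f x ∂(ν : Measure X) := by
    refine LipschitzWith.of_dist_le_mul fun f g => ?_
    rw [dist_eq_norm, ← integral_sub (hint ν f) (hint ν g)]
    simpa [dist_eq_norm] using norm_integral_le_of_norm_le_const (μ := (ν : Measure X))
      (Eventually.of_forall fun x => (f - g).norm_coe_le_norm x)
  have hclosed : IsClosed {f : C(X, 𝕜) | Tendsto (fun s => ∫ x, f x ∂(μ s : Measure X)) l
      (𝓝 (∫ x, f x ∂(π : Measure X)))} :=
    (LipschitzWith.uniformEquicontinuous _ 1 fun s => hlip (μ s)).equicontinuous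
      |>.isClosed_setOfPred_tendsto (hlip π).continuous
  have hspan : ∀ f ∈ Submodule.span 𝕜 S, Tendsto (fun s => ∫ x, f x ∂(μ s : Measure X)) l
      (𝓝 (∫ x, f x ∂(π : Measure X))) := by
    intro f hf
    induction hf using Submodule.span_induction with
    | mem f hf => exact hμ f hf
    | zero => simpa using tendsto_const_nhds
    | add f g _ _ hf hg =>
      simp only [ContinuousMap.add_apply, integral_add (hint _ f) (hint _ g)]
      exact hf.add hg
    | smul c f _ hf =>
      simp only [ContinuousMap.smul_apply, integral_smul]
      exact hf.const_smul c
  rw [ProbabilityMeasure.tendsto_iff_forall_integral_rclike_tendsto 𝕜]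
  intro f
  have hmem : f.toContinuousMap ∈ closure (Submodule.span 𝕜 S : Set C(X, 𝕜)) := by
    rw [← Submodule.topologicalClosure_coe, hS]
    exact mem_univ _
  exact closure_minimal hspan hclosed hmem

theorem tendsto_of_tendsto_kernelNorm {d : ℕ} {h : UnitAddTorus (Fin d) → ℝ} (hh : Continuous h)
    (hF : ∀ ξ : Fin d → ℤ, UnitAddTorus.mFourierCoeff (fun x => (h x : ℂ)) ξ ≠ 0)
    {ι : Type*} {l : Filter ι} {μ : ι → ProbabilityMeasure (UnitAddTorus (Fin d))}
    {π : ProbabilityMeasure (UnitAddTorus (Fin d))}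
    (hμ : Tendsto (fun s => kernelNorm h (diffMeasure (μ s) π)) l (𝓝 0)) :
    Tendsto μ l (𝓝 π) := by
  have hcoeff (ξ : Fin d → ℤ) :
      Tendsto (fun s => fourierStieltjesCoeff (μ s : Measure (UnitAddTorus (Fin d))) ξ) l
        (𝓝 (fourierStieltjesCoeff (π : Measure (UnitAddTorus (Fin d))) ξ)) := by
    rw [tendsto_iff_norm_sub_tendsto_zero]
    have hlim := hμ.div_const ‖UnitAddTorus.mFourierCoeff (fun x => (h x : ℂ)) ξ‖
    rw [zero_div] at hlim
    refine squeeze_zero (fun s => norm_nonneg _) (fun s => ?_) hlim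
    exact (le_div_iff₀' (norm_pos_iff.2 (hF ξ))).2 (norm_mFourierCoeff_mul_le_kernelNorm hh _ π ξ)
  refine tendsto_of_span_topologicalClosure_eq_top ℂ
    (UnitAddTorus.span_mFourier_closure_eq_top (d := Fin d)) ?_
  rintro _ ⟨n, rfl⟩
  simpa only [fourierStieltjesCoeff, neg_neg] using hcoeff (-n)

theorem eventually_exists_nat_rpow_inv_le {β : ℝ} (hβ : 0 < β) (c : ℝ) :
    ∀ᶠ T : ℝ in atTop, ∃ n : ℕ, c ≤ n ∧ (n : ℝ) ^ β⁻¹ ≤ T ∧ (n : ℝ)⁻¹ ≤ 2 * T ^ (-β) := by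
  filter_upwards [(tendsto_rpow_atTop hβ).eventually_ge_atTop (c + 1),
    (tendsto_rpow_atTop hβ).eventually_ge_atTop 2, eventually_ge_atTop 0] with T hTc hT₂ hT
  have hle : (⌊T ^ β⌋₊ : ℝ) ≤ T ^ β := Nat.floor_le (by positivity)
  have hlt : T ^ β < ⌊T ^ β⌋₊ + 1 := Nat.lt_floor_add_one _
  refine ⟨⌊T ^ β⌋₊, by linarith, ?_, ?_⟩
  · calc (⌊T ^ β⌋₊ : ℝ) ^ β⁻¹ ≤ (T ^ β) ^ β⁻¹ := by gcongr
      _ = T := Real.rpow_rpow_inv hT hβ.ne'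
  · rw [Real.rpow_neg hT, ← div_eq_mul_inv, ← inv_div]
    exact inv_anti₀ (by linarith) (by linarith)

theorem rate_exponent_pos {d m : ℕ} (hd : 1 ≤ d) (hm : 1 ≤ m) :
    0 < (m : ℝ) / ((m : ℝ) * ((d : ℝ) + 1) - 1) := by
  have hd' : (1 : ℝ) ≤ d := by exact_mod_cast hd
  have hm' : (1 : ℝ) ≤ m := by exact_mod_cast hm
  exact div_pos (by linarith) (by nlinarith)

theorem rate_exponent_inv {m : ℕ} (hm : m ≠ 0) (d : ℕ) :
    ((m : ℝ) / ((m : ℝ) * ((d : ℝ) + 1) - 1))⁻¹ = d + 1 - (m : ℝ)⁻¹ := by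
  field_simp

theorem exists_curveMeasure_kernelNorm_le {d m : ℕ} (hd : 1 ≤ d) (hm : 1 ≤ m) {α : ℕ → ℝ}
    (hα : ∀ i, 1 ≤ i → i ≤ m → 0 < α i) {h : UnitAddTorus (Fin d) → ℝ} {K : NNReal}
    (hK : LipschitzWith K h) (π : ProbabilityMeasure (UnitAddTorus (Fin d))) :
    ∃ B : ℝ, ∀ᶠ T : ℝ in atTop, ∃ ν ∈ curveMeasures d m α T,
      kernelNorm h (diffMeasure ν π) ≤
        B * T ^ (-((m : ℝ) / ((m : ℝ) * ((d : ℝ) + 1) - 1))) := by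
  set β : ℝ := (m : ℝ) / ((m : ℝ) * ((d : ℝ) + 1) - 1)
  obtain ⟨M, hM⟩ : ∃ M, ∀ x, ‖h x‖ ≤ M := by
    simpa using isCompact_univ.exists_bound_of_continuousOn hK.continuous.continuousOn
  have hM₀ : 0 ≤ M := (norm_nonneg _).trans (hM 0)
  obtain ⟨c, hc₁, hc⟩ := exists_curveMeasure_close (E := ℝ) hα π
  refine ⟨(K + 2 * M * c) * 2, ?_⟩
  filter_upwards [eventually_exists_nat_rpow_inv_le (rate_exponent_pos hd hm) c]
    with T ⟨n, hcn, hnT, hn⟩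
  rw [rate_exponent_inv (Nat.one_le_iff_ne_zero.1 hm)] at hnT
  obtain ⟨ν, hν, hclose⟩ := hc n hcn T hnT
  have hLip (x : UnitAddTorus (Fin d)) : LipschitzWith K fun y => h (x - y) :=
    LipschitzWith.of_dist_le_mul fun y z =>
      (hK.dist_le_mul (x - y) (x - z)).trans_eq (by rw [dist_sub_left])
  refine ⟨ν, hν, ?_⟩
  calc kernelNorm h (diffMeasure ν π) ≤ (K + 2 * M * c) * (n : ℝ)⁻¹ :=
        kernelNorm_le fun x => by
          rw [conv_diffMeasure hK.continuous]
          exact hclose _ K M (hLip x) fun y => hM _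
    _ ≤ (K + 2 * M * c) * (2 * T ^ (-β)) := by gcongr
    _ = (K + 2 * M * c) * 2 * T ^ (-β) := by ring

end LineDrawing

theorem mainTheorem2 (d m : ℕ) (hd : 1 ≤ d) (hm : 1 ≤ m)
    (α : ℕ → ℝ) (hα : ∀ i, 1 ≤ i → i ≤ m → 0 < α i)
    (h : UnitAddTorus (Fin d) → ℝ) (hLip : ∃ L, LipschitzWith L h)
    (π : ProbabilityMeasure (UnitAddTorus (Fin d)))
    (μ : ℝ → ProbabilityMeasure (UnitAddTorus (Fin d)))
    (hμ : ∀ T : ℝ, 0 < T → LineDrawing.IsProjection m α h π T (μ T)) :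
    ((∀ ξ : Fin d → ℤ, UnitAddTorus.mFourierCoeff (fun x => (h x : ℂ)) ξ ≠ 0) →
      Tendsto μ atTop (𝓝 π)) ∧
    (fun T : ℝ => LineDrawing.kernelNorm h (LineDrawing.diffMeasure (μ T) π)) =O[atTop]
      (fun T : ℝ => T ^ (-((m : ℝ) / ((m : ℝ) * ((d : ℝ) + 1) - 1)))) := by
  obtain ⟨K, hK⟩ := hLip
  have hrate : (fun T : ℝ => LineDrawing.kernelNorm h (LineDrawing.diffMeasure (μ T) π)) =O[atTop]
      (fun T : ℝ => T ^ (-((m : ℝ) / ((m : ℝ) * ((d : ℝ) + 1) - 1)))) := by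
    obtain ⟨B, hB⟩ := LineDrawing.exists_curveMeasure_kernelNorm_le hd hm hα hK π
    refine Asymptotics.IsBigO.of_bound B ?_
    filter_upwards [hB, eventually_gt_atTop 0] with T ⟨ν, hν, hle⟩ hT
    rw [Real.norm_of_nonneg (LineDrawing.kernelNorm_nonneg _ _),
      Real.norm_of_nonneg (by positivity)]
    exact ((hμ T hT).2 ν hν).trans hle
  have hlim : Tendsto (fun T => LineDrawing.kernelNorm h (LineDrawing.diffMeasure (μ T) π))
      atTop (𝓝 0) :=
    hrate.trans_tendsto (tendsto_rpow_neg_atTop (LineDrawing.rate_exponent_pos hd hm))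
  exact ⟨fun hF => LineDrawing.tendsto_of_tendsto_kernelNorm hK.continuous hF hlim, hrate⟩
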